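/- **Definitions.** Let $A$ be a set of $m$ buyers and $B$ an infinite set of houses; every buyer has a preference list, i.e. a well-ordering of $B$ (so that there is a favourite house in every nonempty set of houses). A matching is an injective map $\tau:A\to B$, and $s(\tau)=\{\tau(a):a\in A\}$ is its set of sold houses. A matching $\tau$ is Pareto optimal if there are no nonempty $A'\subseteq A$ and matching $\tau'$ that differs from $\tau$ only on $A'$ such that every $a\in A'$ places $\tau'(a)$ strictly higher than $\tau(a)$ in its preference list. A set $E\subseteq B$ is reachable if $E=s(\tau)$ for some Pareto optimal matching $\tau$. Let $f(m)$ be the largest number of reachable sets, taken over all infinite sets $B$ and all $m$-tuples of preference lists. A family $\mathcal F$ of $m$-element sets has property $P$ if for every integer $k\ge 1$ and all $F_1,\dots,F_k\in\mathcal F$ there is $j\in\{1,\dots,k\}$ with $|F_j\setminus\bigcup_{i\ne j}F_i|\le\lfloor m/k\rfloor$. Let $g(m)$ be the largest cardinality of a family of $m$-element sets with property $P$. **Theorem.** (i) Let $\ell=\ell(m)$ be the largest integer with $\ell^\ell\le m$. If $m$ is sufficiently large, then $f(m)\le\binom{2m-\ell+4}{m}$; that is, for any preference lists of $m$ buyers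 there are at most $\binom{2m-\ell+4}{m}$ reachable sets. (ii) For every $m\ge 1$, every family $\mathcal F$ of $m$-element sets with property $P$ satisfies $|\mathcal F|\le\binom{2m-1}{m}$; hence $g(m)\le\binom{2m-1}{m}$. (For $m=0$ this holds as well, with the bound read as $1$.) -/

import Mathlib

universe u

/-- A matching of the buyers `A` into the houses `B` is an embedding `A ↪ B`, and `pref a x y` says
that buyer `a` places house `x` strictly before (higher than) house `y`.
`A'` is a blocking coalition for `τ` if it is nonempty and some matching `τ'` that differs from `τ`
only on `A'` gives every member of `A'` a house that this member places higher. -/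
def IsBlockingCoalition {A B : Type*} (pref : A → B → B → Prop) (τ : A ↪ B) (A' : Set A) : Prop :=
  A'.Nonempty ∧ ∃ τ' : A ↪ B, (∀ a, a ∉ A' → τ' a = τ a) ∧ ∀ a ∈ A', pref a (τ' a) (τ a)

/-- Pareto optimal matchings. -/
def IsPOM {A B : Type*} (pref : A → B → B → Prop) (τ : A ↪ B) : Prop :=
  ¬ ∃ A' : Set A, IsBlockingCoalition pref τ A'

/-- The set of houses that are sold in a matching. -/
def soldHouses {A B : Type*} [Fintype A] (τ : A ↪ B) : Finset B :=
  Finset.univ.map τ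

/-- The family of reachable sets of houses. -/
def reachableSets {A B : Type*} [Fintype A] (pref : A → B → B → Prop) : Set (Finset B) :=
  {E | ∃ τ : A ↪ B, IsPOM pref τ ∧ soldHouses τ = E}

/-- `f(m)`: the largest number of reachable sets, over all infinite sets `B` of houses and all
`m`-tuples of preference lists. A preference list is a well-ordering of `B`: there is a favourite
house in every nonempty set of houses. -/
noncomputable def maxReachable (m : ℕ) : ℕ∞ :=
  ⨆ (B : Type u) (_ : Infinite B) (pref : Fin m → B → B → Prop)
    (_ : ∀ a, IsWellOrder B (pref a)), (reachableSets pref).encard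

/-- `F` is a family of `m`-element sets with property `P`. -/
def HasPropertyP {α : Type*} (m : ℕ) (F : Set (Finset α)) : Prop :=
  (∀ S ∈ F, S.card = m) ∧
    ∀ k : ℕ, 1 ≤ k → ∀ G : Fin k → Finset α, (∀ i, G i ∈ F) →
      ∃ j, ((G j : Set α) \ ⋃ i, ⋃ (_ : i ≠ j), (G i : Set α)).ncard ≤ m / k

/-- `g(m)`: the largest cardinality of a family of `m`-element sets with property `P`. -/
noncomputable def maxPropertyP (m : ℕ) : ℕ∞ :=
  ⨆ (α : Type u) (F : Set (Finset α)) (_ : HasPropertyP m F), F.encard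

/-!
Both bounds rest on the skew Bollobás inequality. If each member `E` of a family is the only member
disjoint from some set of size `b`, and all members have at most `a` points outside a common subset
`T`, then the family has at most `(a + b).choose b` members. A member of a family with property `P`
is isolated in this way by a minimal transversal of the other members minus it: every point of the
transversal has a private set of the family, so property `P` bounds its size by `m`. Since the
family is intersecting, the pairs may be listed a second time with the two entries exchanged, which
halves the bound to `(2 * m).choose m / 2 = (2 * m - 1).choose m`.

A reachable set `E` is isolated by the favourites of the buyers among the houses outside `E`. If all
reachable sets contain a common `T`, then the bound is `(2 * m - #T).choose m`. To save a factor
`2 ^ s`, let `X` be the set of houses that belong to all reachable sets. If `s ≤ #X`, then `T ⊆ X`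
can be chosen with `s` points. Otherwise consider the favourites outside `X`. In a Pareto optimal
matching a buyer whose favourite is unsold receives a house of `X`, so each reachable set misses the
favourites of at most `#X` buyers; hence no house is the favourite of more than `s` buyers, and if
`6 * s ^ 2 ≤ m` then there are `6 * s` different favourites. Each reachable set contains a set `T`
of `5 * s` of them, which saves a factor `2 ^ (5 * s)`, and there are only
`(6 * s).choose s ≤ 2 ^ (4 * s)` choices of `T`.
-/

open Finset

section Choose

theorem two_mul_choose_le_choose_succ {n m : ℕ} (h : n + 1 ≤ 2 * m) :
    2 * n.choose m ≤ (n + 1).choose m := by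
  obtain ⟨k, rfl⟩ : ∃ k, m = k + 1 := ⟨m - 1, by omega⟩
  have hanti : n.choose (k + 1) ≤ n.choose k := by
    refine Nat.le_of_mul_le_mul_right ?_ k.succ_pos
    rw [Nat.succ_eq_add_one, Nat.choose_succ_right_eq]
    exact Nat.mul_le_mul_left _ (by omega)
  rw [Nat.choose_succ_succ']
  omega

theorem two_pow_mul_choose_le_choose_add {n m r : ℕ} (h : n + r ≤ 2 * m) :
    2 ^ r * n.choose m ≤ (n + r).choose m := by
  induction r with
  | zero => simp
  | succ r ih =>
    calc 2 ^ (r + 1) * n.choose m = 2 * (2 ^ r * n.choose m) := by ring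
      _ ≤ 2 * (n + r).choose m := Nat.mul_le_mul_left 2 (ih (by omega))
      _ ≤ (n + (r + 1)).choose m := two_mul_choose_le_choose_succ (by omega)

theorem choose_mul_pow_le_add_one_pow (n k x : ℕ) (hk : k ≤ n) :
    n.choose k * x ^ (n - k) ≤ (x + 1) ^ n := by
  rw [add_comm x, add_pow]
  refine le_trans (by simp [mul_comm]) (single_le_sum_of_canonicallyOrdered
    (f := fun i => 1 ^ i * x ^ (n - i) * n.choose i) (mem_range_succ_iff.mpr hk))

theorem choose_six_mul_le_two_pow (s : ℕ) : (6 * s).choose s ≤ 2 ^ (4 * s) := by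
  refine Nat.le_of_mul_le_mul_right ?_ (show 0 < 5 ^ (5 * s) by positivity)
  calc (6 * s).choose s * 5 ^ (5 * s) = (6 * s).choose s * 5 ^ (6 * s - s) := by
        rw [show 6 * s - s = 5 * s by omega]
    _ ≤ (5 + 1) ^ (6 * s) := choose_mul_pow_le_add_one_pow _ _ _ (by omega)
    _ = (6 ^ 6) ^ s := by rw [← pow_mul]
    _ ≤ (2 ^ 4 * 5 ^ 5) ^ s := Nat.pow_le_pow_left (by norm_num) s
    _ = 2 ^ (4 * s) * 5 ^ (5 * s) := by rw [mul_pow, ← pow_mul, ← pow_mul]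

theorem choose_six_mul_mul_choose_le {m s : ℕ} (h : 6 * s ≤ m) :
    (6 * s).choose (5 * s) * (m - 5 * s + m).choose m ≤ (2 * m - s).choose m :=
  calc (6 * s).choose (5 * s) * (m - 5 * s + m).choose m
      = (6 * s).choose s * (2 * m - 5 * s).choose m := by
        rw [← Nat.choose_symm_of_eq_add (show 6 * s = 5 * s + s by ring),
          show m - 5 * s + m = 2 * m - 5 * s by omega]
    _ ≤ 2 ^ (4 * s) * (2 * m - 5 * s).choose m :=
        Nat.mul_le_mul_right _ (choose_six_mul_le_two_pow s)
    _ ≤ (2 * m - 5 * s + 4 * s).choose m := two_pow_mul_choose_le_choose_add (by omega)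
    _ = (2 * m - s).choose m := by rw [show 2 * m - 5 * s + 4 * s = 2 * m - s by omega]

theorem six_mul_sq_sub_four_le_of_pow_self_le {l m : ℕ} (h : l ^ l ≤ m) :
    6 * (l - 4) ^ 2 ≤ m := by
  rcases lt_or_ge l 4 with hl | hl
  · simp [Nat.sub_eq_zero_of_le hl.le]
  · calc 6 * (l - 4) ^ 2 ≤ l ^ 2 * l ^ 2 := by
          gcongr
          · nlinarith
          · exact Nat.sub_le l 4
      _ = l ^ 4 := by ring
      _ ≤ l ^ l := Nat.pow_le_pow_right (by omega) hl
      _ ≤ m := h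

end Choose

section TriangularEvaluation

variable {ι κ σ K : Type*} [Fintype ι] [LinearOrder ι] [Fintype κ] [Fintype σ] [Field K]

theorem card_le_card_of_isLowerTriangular_mul {V : Matrix ι κ K} {W : Matrix κ ι K}
    (htri : (V * W).IsLowerTriangular) (hdiag : ∀ i, (V * W) i i ≠ 0) :
    Fintype.card ι ≤ Fintype.card κ := by
  have hunit : IsUnit (V * W) := by
    rw [Matrix.isUnit_iff_isUnit_det, Matrix.det_of_isLowerTriangular _ htri, isUnit_iff_ne_zero]
    exact prod_ne_zero_iff.mpr fun i _ => hdiag i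
  calc Fintype.card ι = (V * W).rank := (Matrix.rank_of_isUnit _ hunit).symm
    _ ≤ V.rank := Matrix.rank_mul_le_left _ _
    _ ≤ Fintype.card κ := Matrix.rank_le_card_width _

theorem eval_eq_sum_finsuppAntidiag {R : Type*} [CommSemiring R] [DecidableEq σ]
    {p : MvPolynomial σ R} {n : ℕ} (hp : p.IsHomogeneous n) (x : σ → R) :
    p.eval x = ∑ d ∈ finsuppAntidiag univ n, p.coeff d * ∏ i, x i ^ d i := by
  rw [MvPolynomial.eval_eq']
  refine sum_subset (fun d hd => ?_) fun d _ hd => ?_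
  · have hdeg := hp (MvPolynomial.mem_support_iff.mp hd)
    rw [Finsupp.weight_apply, Finsupp.sum_fintype _ _ (by simp)] at hdeg
    simpa [mem_finsuppAntidiag] using hdeg
  · rw [MvPolynomial.notMem_support_iff.mp hd, zero_mul]

theorem card_le_choose_of_triangular_eval {b : ℕ} (c : ι → σ → K) (φ : ι → MvPolynomial σ K)
    (hφ : ∀ i, (φ i).IsHomogeneous b) (hdiag : ∀ i, (φ i).eval (c i) ≠ 0)
    (htri : ∀ i j, i < j → (φ j).eval (c i) = 0) :
    Fintype.card ι ≤ (Fintype.card σ + b - 1).choose b := by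
  classical
  let V : Matrix ι (finsuppAntidiag (univ : Finset σ) b) K := .of fun i d => ∏ k, c i k ^ d.1 k
  let W : Matrix (finsuppAntidiag (univ : Finset σ) b) ι K := .of fun d j => (φ j).coeff d.1
  have hVW (i j : ι) : (V * W) i j = (φ j).eval (c i) := by
    rw [eval_eq_sum_finsuppAntidiag (hφ j), ← sum_coe_sort, Matrix.mul_apply]
    exact sum_congr rfl fun d _ => mul_comm _ _
  calc Fintype.card ι ≤ Fintype.card (finsuppAntidiag (univ : Finset σ) b) :=
        card_le_card_of_isLowerTriangular_mul (V := V) (W := W)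
          (fun i j hij => (hVW i j).trans (htri i j hij)) fun i => (hVW i i).trans_ne (hdiag i)
    _ = (Fintype.card σ + b - 1).choose b := by
        rw [Fintype.card_coe, card_finsuppAntidiag_nat_eq_choose, card_univ]

end TriangularEvaluation

section SkewSetPairs

open Polynomial

variable {α R : Type*} [CommRing R] {t : α → R} {a b : ℕ} {s : Finset α}

/-- The monic polynomial of degree `a` that vanishes on `t '' s`, for a set `s` of at most `a`
points. Its coefficients are the point that represents the first set of a set pair. If `s` has fewer
than `a` points, then the polynomial has additional roots at `0`. -/
noncomputable def setPoly (t : α → R) (a : ℕ) (s : Finset α) : R[X] :=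
  X ^ (a - #s) * Lagrange.nodal s t

/-- The form of degree `b` that sends the coefficients of a monic polynomial `p` of degree `a` to
`∏ y ∈ s, p.eval (t y)`, for a set `s` of at most `b` points; it represents the second set of a set
pair. If `s` has fewer than `b` points, then the degree is made up by powers of the last variable,
at which the leading coefficient `1` of `p` is substituted. -/
noncomputable def setForm (t : α → R) (a b : ℕ) (s : Finset α) : MvPolynomial (Fin (a + 1)) R :=
  (∏ y ∈ s, ∑ k : Fin (a + 1), MvPolynomial.C (t y ^ (k : ℕ)) * MvPolynomial.X k) *
    MvPolynomial.X (Fin.last a) ^ (b - #s)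

theorem monic_setPoly : (setPoly t a s).Monic :=
  (monic_X_pow _).mul Lagrange.nodal_monic

theorem natDegree_setPoly [Nontrivial R] (hs : #s ≤ a) : (setPoly t a s).natDegree = a := by
  rw [setPoly, (monic_X_pow _).natDegree_mul Lagrange.nodal_monic, natDegree_X_pow,
    Lagrange.natDegree_nodal, Nat.sub_add_cancel hs]

theorem eval_setPoly_eq_zero_iff [IsDomain R] (ht : t.Injective) (ht₀ : ∀ x, t x ≠ 0) {y : α} :
    (setPoly t a s).eval (t y) = 0 ↔ y ∈ s := by
  simp [setPoly, Lagrange.eval_nodal, prod_eq_zero_iff, sub_eq_zero, ht.eq_iff, ht₀]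

theorem isHomogeneous_setForm (hs : #s ≤ b) : (setForm t a b s).IsHomogeneous b := by
  have hprod : (∏ y ∈ s, ∑ k : Fin (a + 1), MvPolynomial.C (t y ^ (k : ℕ)) *
      (MvPolynomial.X k : MvPolynomial (Fin (a + 1)) R)).IsHomogeneous (∑ _y ∈ s, 1) :=
    .prod _ _ _ fun y _ => .sum _ _ _ fun k _ => MvPolynomial.isHomogeneous_C_mul_X _ _
  have hmul := hprod.mul (MvPolynomial.isHomogeneous_X_pow (R := R) (Fin.last a) (b - #s))
  rwa [← card_eq_sum_ones, Nat.add_sub_cancel' hs] at hmul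

theorem eval_setForm {p : R[X]} (hp : p.Monic) (hdeg : p.natDegree = a) :
    (setForm t a b s).eval (fun k : Fin (a + 1) => p.coeff k) = ∏ y ∈ s, p.eval (t y) := by
  have hlead : p.coeff a = 1 := hdeg ▸ hp.coeff_natDegree
  simp only [setForm, map_mul, map_pow, map_prod, map_sum, MvPolynomial.eval_C,
    MvPolynomial.eval_X, Fin.val_last, hlead, one_pow, mul_one]
  refine prod_congr rfl fun y _ => ?_
  rw [eval_eq_sum_range, hdeg, sum_range]
  exact sum_congr rfl fun k _ => mul_comm _ _

theorem card_le_choose_of_skew_set_pairs {ι : Type*} [Fintype ι] [LinearOrder ι]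
    (A B : ι → Finset α) (hA : ∀ i, #(A i) ≤ a) (hB : ∀ i, #(B i) ≤ b)
    (hdisj : ∀ i, Disjoint (A i) (B i)) (hmeet : ∀ i j, i < j → ¬ Disjoint (A i) (B j)) :
    Fintype.card ι ≤ (a + b).choose b := by
  let t : α → FractionRing (MvPolynomial α ℚ) := fun x =>
    algebraMap (MvPolynomial α ℚ) _ (MvPolynomial.X x)
  have ht : t.Injective :=
    (IsFractionRing.injective (MvPolynomial α ℚ) _).comp MvPolynomial.X_injective
  have ht₀ (x : α) : t x ≠ 0 := by simp [t]
  have heval (i j : ι) : (setForm t a b (B j)).eval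
      (fun k : Fin (a + 1) => (setPoly t a (A i)).coeff k) = 0 ↔ ¬ Disjoint (A i) (B j) := by
    rw [eval_setForm monic_setPoly (natDegree_setPoly (hA i)), prod_eq_zero_iff,
      not_disjoint_iff]
    simp only [eval_setPoly_eq_zero_iff ht ht₀, and_comm]
  have hcard := card_le_choose_of_triangular_eval
    (fun i (k : Fin (a + 1)) => (setPoly t a (A i)).coeff k) (fun j => setForm t a b (B j))
    (fun j => isHomogeneous_setForm (hB j)) (fun i h => (heval i i).mp h (hdisj i))
    fun i j hij => (heval i j).mpr (hmeet i j hij)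
  rwa [Fintype.card_fin, show a + 1 + b - 1 = a + b by omega] at hcard

end SkewSetPairs

section Isolates

variable {α : Type*} {S : Set (Finset α)} {a b : ℕ}

/-- `D` isolates `E` in the family `S` if `E` is disjoint from `D` and no other member of `S` is.
The pairs `(E, D)` are those to which the skew Bollobás inequality is applied. -/
def Isolates (D : Finset α) (S : Set (Finset α)) (E : Finset α) : Prop :=
  Disjoint E D ∧ ∀ E' ∈ S, Disjoint E' D → E' = E

theorem Isolates.mono {D E : Finset α} {S' : Set (Finset α)} (h : Isolates D S E)
    (hS : S' ⊆ S) : Isolates D S' E :=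
  ⟨h.1, fun E' hE' => h.2 E' (hS hE')⟩

theorem encard_le_of_forall_finset_card_le {β : Type*} {S : Set β} {n : ℕ}
    (h : ∀ T : Finset β, ↑T ⊆ S → #T ≤ n) : S.encard ≤ n := by
  refine ENat.forall_natCast_le_iff_le.mp fun k hk => ?_
  obtain ⟨T, hTS, hTk⟩ := Set.exists_subset_encard_eq hk
  lift T to Finset β using Set.finite_of_encard_eq_coe hTk
  rw [← hTk, Set.encard_coe_eq_coe_finsetCard]
  exact_mod_cast h T hTS

theorem encard_le_choose_of_isolates [DecidableEq α] (T : Finset α) (hT : ∀ E ∈ S, T ⊆ E)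
    (hcard : ∀ E ∈ S, #(E \ T) ≤ a) (hiso : ∀ E ∈ S, ∃ D, #D ≤ b ∧ Isolates D S E) :
    S.encard ≤ (a + b).choose b := by
  refine encard_le_of_forall_finset_card_le fun F hF => ?_
  choose! D hD hiso using hiso
  let e := F.equivFin.symm
  have hS (i : Fin #F) : (e i).1 ∈ S := hF (e i).2
  have hskew := card_le_choose_of_skew_set_pairs (fun i => (e i).1 \ T) (fun i => D (e i))
    (fun i => hcard _ (hS i)) (fun i => hD _ (hS i))
    (fun i => (hiso _ (hS i)).1.mono_left sdiff_subset) fun i j hij hdisj => by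
      have hTD : Disjoint T (D (e j)) := (hiso _ (hS j)).1.mono_left (hT _ (hS j))
      have hED : Disjoint (e i).1 (D (e j)) := by
        rw [← sdiff_union_of_subset (hT _ (hS i))]
        exact disjoint_union_left.mpr ⟨hdisj, hTD⟩
      exact hij.ne (e.injective (Subtype.ext ((hiso _ (hS j)).2 _ (hS i) hED)))
  rwa [Fintype.card_fin] at hskew

theorem card_le_choose_of_intersecting_of_isolates [DecidableEq α] {F : Finset (Finset α)}
    (hinter : (F : Set (Finset α)).Intersecting) (hcard : ∀ E ∈ F, #E ≤ a)
    (hiso : ∀ E ∈ F, ∃ D, #D ≤ a ∧ Isolates D F E) :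
    #F ≤ (2 * a - 1).choose a := by
  choose! D hD hiso using hiso
  let e := F.equivFin.symm
  have hmeet (i j : Fin #F) (hij : i ≠ j) : ¬ Disjoint (e i).1 (D (e j)) :=
    fun h => hij (e.injective (Subtype.ext ((hiso _ (e j).2).2 _ (e i).2 h)))
  have hdouble := card_le_choose_of_skew_set_pairs (a := a) (b := a)
    (fun i : Fin #F ⊕ₗ Fin #F => Sum.elim (fun i => (e i).1) (fun i => D (e i)) (ofLex i))
    (fun i => Sum.elim (fun i => D (e i)) (fun i => (e i).1) (ofLex i))
    (by rintro (i | i); exacts [hcard _ (e i).2, hD _ (e i).2])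
    (by rintro (i | i); exacts [hD _ (e i).2, hcard _ (e i).2])
    (by rintro (i | i); exacts [(hiso _ (e i).2).1, (hiso _ (e i).2).1.symm])
    (by
      rintro (i | i) (j | j) hij
      · exact hmeet i j (Sum.Lex.inl_lt_inl_iff.mp hij).ne
      · exact hinter (e i).2 (e j).2
      · exact absurd hij Sum.Lex.not_inr_lt_inl
      · exact fun h => hmeet j i (Sum.Lex.inr_lt_inr_iff.mp hij).ne' h.symm)
  rw [Fintype.card_lex, Fintype.card_sum, Fintype.card_fin] at hdouble
  cases a with
  | zero =>
    have hempty (E : Finset α) (hE : E ∈ F) : False := by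
      obtain rfl := card_eq_zero.mp (Nat.le_zero.mp (hcard E hE))
      exact hinter.bot_notMem hE
    simp [eq_empty_of_forall_notMem hempty]
  | succ n =>
    rw [show n + 1 + (n + 1) = 2 * n + 1 + 1 by ring, Nat.choose_succ_succ',
      ← Nat.choose_symm_half] at hdouble
    rw [show 2 * (n + 1) - 1 = 2 * n + 1 by omega]
    omega

theorem exists_minimal_isolates {F : Finset (Finset α)} {E : Finset α}
    (hE : ∀ E' ∈ F, E' ⊆ E → E' = E) : ∃ D, Minimal (Isolates · (F : Set (Finset α)) E) D := by
  classical
  refine exists_minimal_of_wellFoundedLT _ ⟨F.biUnion id \ E, disjoint_sdiff, fun E' hE' hd => ?_⟩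
  refine hE E' hE' fun x hx => by_contra fun hxE => disjoint_left.mp hd hx ?_
  exact mem_sdiff.mpr ⟨mem_biUnion.mpr ⟨E', hE', hx⟩, hxE⟩

theorem exists_private_of_minimal_isolates {D E : Finset α} (hD : Minimal (Isolates · S E) D)
    {x : α} (hx : x ∈ D) : ∃ E' ∈ S, ∀ y ∈ D, y ∈ E' ↔ y = x := by
  classical
  have herase : ¬ Isolates (D.erase x) S E := hD.not_prop_of_lt (erase_ssubset hx)
  obtain ⟨E', hE', hdisj, hne⟩ : ∃ E' ∈ S, Disjoint E' (D.erase x) ∧ E' ≠ E := by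
    by_contra! h
    exact herase ⟨hD.prop.1.mono_right (erase_subset x D), h⟩
  have hsub (y : α) (hy : y ∈ D) (hyE : y ∈ E') : y = x :=
    by_contra fun hyx => disjoint_left.mp hdisj hyE (mem_erase.mpr ⟨hyx, hy⟩)
  obtain ⟨y, hyE, hyD⟩ := not_disjoint_iff.mp fun h => hne (hD.prop.2 E' hE' h)
  have hxE : x ∈ E' := hsub y hyD hyE ▸ hyE
  exact ⟨E', hE', fun z hz => ⟨hsub z hz, fun h => h ▸ hxE⟩⟩

theorem encard_le_choose_mul_of_le_card_inter [DecidableEq α] {D : Finset α} {t : ℕ} {N : ℕ∞}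
    (hD : ∀ E ∈ S, t ≤ #(E ∩ D)) (hN : ∀ T, #T = t → {E ∈ S | T ⊆ E}.encard ≤ N) :
    S.encard ≤ (#D).choose t * N := by
  have hcover : S ⊆ ⋃ T ∈ D.powersetCard t, {E ∈ S | T ⊆ E} := fun E hE => by
    obtain ⟨T, hT, hTt⟩ := exists_subset_card_eq (hD E hE)
    exact Set.mem_biUnion (mem_powersetCard.mpr ⟨hT.trans inter_subset_right, hTt⟩)
      ⟨hE, hT.trans inter_subset_left⟩
  calc S.encard ≤ ∑ T ∈ D.powersetCard t, {E ∈ S | T ⊆ E}.encard :=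
        (Set.encard_le_encard hcover).trans (set_encard_biUnion_le _ _)
    _ ≤ #(D.powersetCard t) • N :=
        sum_le_card_nsmul _ _ _ fun T hT => hN T (mem_powersetCard.mp hT).2
    _ = (#D).choose t * N := by rw [card_powersetCard, nsmul_eq_mul]

end Isolates

section PropertyP

variable {α : Type*} {m : ℕ} {F : Set (Finset α)}

theorem HasPropertyP.exists_card_private_le {ι : Type*} [Fintype ι] [Nonempty ι]
    (hF : HasPropertyP m F) {G P : ι → Finset α} (hG : ∀ i, G i ∈ F) (hPG : ∀ i, P i ⊆ G i)
    (hP : ∀ i j, i ≠ j → Disjoint (G i) (P j)) : ∃ j, #(P j) ≤ m / Fintype.card ι := by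
  let e := (Fintype.equivFin ι).symm
  obtain ⟨j, hj⟩ := hF.2 (Fintype.card ι) Fintype.card_pos (G ∘ e) fun i => hG _
  refine ⟨e j, le_trans ?_ hj⟩
  rw [← Set.ncard_coe_finset]
  refine Set.ncard_le_ncard (fun x hx => ⟨hPG _ hx, ?_⟩)
    ((finite_toSet _).subset Set.sdiff_subset)
  simp only [Set.mem_iUnion, not_exists]
  exact fun i hij hxi => disjoint_left.mp (hP _ _ (e.injective.ne hij)) hxi hx

theorem HasPropertyP.intersecting [DecidableEq α] (hF : HasPropertyP m F) (hm : m ≠ 0) :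
    F.Intersecting := by
  intro E hE E' hE' hdisj
  let G : Bool → Finset α := fun i => cond i E E'
  have hG (i : Bool) : G i ∈ F := by cases i <;> assumption
  obtain ⟨j, hj⟩ := hF.exists_card_private_le hG (fun _ => subset_rfl) <| by
    rintro (_ | _) (_ | _) h
    exacts [absurd rfl h, hdisj.symm, hdisj, absurd rfl h]
  rw [hF.1 _ (hG j), Fintype.card_bool] at hj
  omega

theorem HasPropertyP.card_le_of_forall_private (hF : HasPropertyP m F) {D : Finset α}
    (hD : ∀ x ∈ D, ∃ E ∈ F, ∀ y ∈ D, y ∈ E ↔ y = x) : #D ≤ m := by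
  rcases D.eq_empty_or_nonempty with rfl | hne
  · exact Nat.zero_le m
  choose! G hGF hG using hD
  have := hne.to_subtype
  obtain ⟨x, hx⟩ := hF.exists_card_private_le (G := fun x : D => G x) (P := fun x => {x.1})
    (fun x => hGF x x.2) (fun x => by simpa using (hG x x.2 x x.2).mpr rfl) fun x y hxy => by
      simpa [hG x x.2 y y.2] using fun h => hxy h.symm
  rw [card_singleton, Fintype.card_coe, Nat.one_le_div_iff hne.card_pos] at hx
  exact hx

theorem HasPropertyP.encard_le (hF : HasPropertyP m F) : F.encard ≤ (2 * m - 1).choose m := by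
  classical
  refine encard_le_of_forall_finset_card_le fun T hT => ?_
  rcases eq_or_ne m 0 with rfl | hm
  · refine card_le_one.mpr fun E hE E' hE' => ?_
    rw [card_eq_zero.mp (hF.1 E (hT hE)), card_eq_zero.mp (hF.1 E' (hT hE'))]
  refine card_le_choose_of_intersecting_of_isolates ((hF.intersecting hm).mono hT)
    (fun E hE => (hF.1 E (hT hE)).le) fun E hE => ?_
  obtain ⟨D, hD⟩ := exists_minimal_isolates (F := T) (E := E) fun E' hE' hsub =>
    eq_of_subset_of_card_le hsub (by rw [hF.1 E (hT hE), hF.1 E' (hT hE')])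
  refine ⟨D, hF.card_le_of_forall_private fun x hx => ?_, hD.prop⟩
  obtain ⟨E', hE', h⟩ := exists_private_of_minimal_isolates hD hx
  exact ⟨E', hT hE', h⟩

end PropertyP

section Matchings

variable {A B : Type*} {pref : A → B → B → Prop} {τ : A ↪ B}

theorem IsPOM.not_pref_of_notMem_range (hτ : IsPOM pref τ) (a : A) {b : B}
    (hb : b ∉ Set.range τ) : ¬ pref a b (τ a) := by
  classical
  intro h
  refine hτ ⟨{a}, ⟨a, rfl⟩, τ.setValue a b, fun a' ha' => ?_, ?_⟩
  · exact Function.Embedding.setValue_eq_of_ne ha' fun h' => hb ⟨a', h'⟩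
  · rintro _ rfl
    rwa [Function.Embedding.setValue_eq]

/-- The house that a buyer places highest among those outside `X`. -/
noncomputable def favourite (pref : A → B → B → Prop) [∀ a, IsWellOrder B (pref a)] (X : Set B)
    (hX : Xᶜ.Nonempty) (a : A) : B :=
  (IsWellFounded.wf : WellFounded (pref a)).min Xᶜ hX

variable [∀ a, IsWellOrder B (pref a)]

theorem favourite_notMem {X : Set B} (hX : Xᶜ.Nonempty) (a : A) : favourite pref X hX a ∉ X :=
  WellFounded.min_mem _ _ hX

theorem IsPOM.favourite_mem_range (hτ : IsPOM pref τ) {X : Set B} (hX : Xᶜ.Nonempty) {a : A}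
    (ha : τ a ∉ X) : favourite pref X hX a ∈ Set.range τ := by
  by_contra hfav
  refine hfav ⟨a, Std.Trichotomous.trichotomous (r := pref a) _ _ ?_ ?_⟩
  · exact WellFounded.not_lt_min _ Xᶜ ha
  · exact hτ.not_pref_of_notMem_range a hfav

theorem IsPOM.card_le_of_favourite_notMem_range (hτ : IsPOM pref τ) {X : Finset B}
    (hX : (X : Set B)ᶜ.Nonempty) {S : Finset A}
    (hS : ∀ a ∈ S, favourite pref X hX a ∉ Set.range τ) : #S ≤ #X :=
  card_le_card_of_injOn τ (fun a ha => by_contra fun h => hS a ha (hτ.favourite_mem_range hX h))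
    τ.injective.injOn

end Matchings

section ReachableSets

variable {A B : Type*} [Fintype A] {pref : A → B → B → Prop}

theorem coe_soldHouses (τ : A ↪ B) : (soldHouses τ : Set B) = Set.range τ := by
  simp [soldHouses]

theorem card_of_mem_reachableSets {E : Finset B} (hE : E ∈ reachableSets pref) :
    #E = Fintype.card A := by
  obtain ⟨τ, -, rfl⟩ := hE
  exact card_map τ

variable [∀ a, IsWellOrder B (pref a)]

theorem subset_of_disjoint_image_favourite [DecidableEq B] {E : Finset B}
    (hE : E ∈ reachableSets pref) {X : Set B} (hX : Xᶜ.Nonempty)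
    (hdisj : Disjoint E (univ.image (favourite pref X hX))) : ↑E ⊆ X := by
  obtain ⟨τ, hτ, rfl⟩ := hE
  rw [coe_soldHouses]
  rintro _ ⟨a, rfl⟩
  by_contra ha
  refine disjoint_left.mp hdisj ?_ (mem_image_of_mem _ (mem_univ a))
  rw [← mem_coe, coe_soldHouses]
  exact hτ.favourite_mem_range hX ha

theorem exists_isolates_of_mem_reachableSets {E : Finset B} (hE : E ∈ reachableSets pref) :
    ∃ D, #D ≤ Fintype.card A ∧ Isolates D (reachableSets pref) E := by
  classical
  have eq_of_subset {E' : Finset B} (hE' : E' ∈ reachableSets pref) (h : E' ⊆ E) : E' = E :=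
    eq_of_subset_of_card_le h
      (by rw [card_of_mem_reachableSets hE, card_of_mem_reachableSets hE'])
  rcases (E : Set B)ᶜ.eq_empty_or_nonempty with huniv | hne
  · refine ⟨∅, Nat.zero_le _, disjoint_empty_right E, fun E' hE' _ => eq_of_subset hE' ?_⟩
    rw [← coe_subset, Set.compl_empty_iff.mp huniv]
    exact Set.subset_univ _
  · refine ⟨univ.image (favourite pref E hne), card_image_le, ?_, fun E' hE' hd => ?_⟩
    · simpa [disjoint_right] using favourite_notMem hne
    · exact eq_of_subset hE' (subset_of_disjoint_image_favourite hE' hne hd)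

theorem encard_reachableSets_superset_le (T : Finset B) :
    {E ∈ reachableSets pref | T ⊆ E}.encard ≤
      (Fintype.card A - #T + Fintype.card A).choose (Fintype.card A) := by
  classical
  refine encard_le_choose_of_isolates T (fun E hE => hE.2) (fun E hE => ?_) fun E hE => ?_
  · rw [card_sdiff_of_subset hE.2, card_of_mem_reachableSets hE.1]
  · obtain ⟨D, hD, hiso⟩ := exists_isolates_of_mem_reachableSets hE.1
    exact ⟨D, hD, hiso.mono fun E' hE' => hE'.1⟩

theorem card_image_favourite_sdiff_le [DecidableEq B] {E X : Finset B}
    (hE : E ∈ reachableSets pref) (hX : (X : Set B)ᶜ.Nonempty) :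
    #(univ.image (favourite pref X hX) \ E) ≤ #X := by
  obtain ⟨τ, hτ, rfl⟩ := hE
  rw [sdiff_eq_filter, filter_image]
  refine card_image_le.trans (hτ.card_le_of_favourite_notMem_range hX fun a ha => ?_)
  rw [← coe_soldHouses, mem_coe]
  exact (mem_filter.mp ha).2

theorem card_le_mul_card_image_favourite [DecidableEq B] {X : Finset B}
    (hX : (X : Set B)ᶜ.Nonempty) (hmiss : ∀ b ∉ X, ∃ E ∈ reachableSets pref, b ∉ E) :
    Fintype.card A ≤ #X * #(univ.image (favourite pref X hX)) := by
  refine card_le_mul_card_image univ #X fun b hb => ?_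
  obtain ⟨a, -, rfl⟩ := mem_image.mp hb
  obtain ⟨_, ⟨τ, hτ, rfl⟩, hunsold⟩ := hmiss _ (favourite_notMem (pref := pref) hX a)
  refine hτ.card_le_of_favourite_notMem_range hX fun a' ha' => ?_
  rwa [(mem_filter.mp ha').2, ← coe_soldHouses, mem_coe]

theorem encard_reachableSets_le_of_card_le {X : Finset B} (hX : (X : Set B)ᶜ.Nonempty)
    (hmiss : ∀ b ∉ X, ∃ E ∈ reachableSets pref, b ∉ E) {s : ℕ} (hs : s ≠ 0) (hXs : #X ≤ s)
    (hsA : 6 * s ^ 2 ≤ Fintype.card A) :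
    (reachableSets pref).encard ≤ (2 * Fintype.card A - s).choose (Fintype.card A) := by
  classical
  set m := Fintype.card A
  have hfav : 6 * s ≤ #(univ.image (favourite pref X hX)) := by
    refine Nat.le_of_mul_le_mul_left ?_ (Nat.pos_of_ne_zero hs)
    calc s * (6 * s) = 6 * s ^ 2 := by ring
      _ ≤ #X * _ := hsA.trans (card_le_mul_card_image_favourite hX hmiss)
      _ ≤ s * _ := Nat.mul_le_mul_right _ hXs
  obtain ⟨D, hDfav, hD⟩ := exists_subset_card_eq hfav
  have hinter (E : Finset B) (hE : E ∈ reachableSets pref) : 5 * s ≤ #(E ∩ D) := by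
    have hmissed : #(D \ E) ≤ s := (card_le_card (sdiff_subset_sdiff hDfav subset_rfl)).trans
      ((card_image_favourite_sdiff_le hE hX).trans hXs)
    have := card_sdiff_add_card_inter D E
    rw [inter_comm]
    omega
  have hsm : 6 * s ≤ m := (Nat.mul_le_mul_left 6 (Nat.le_self_pow two_ne_zero s)).trans hsA
  calc (reachableSets pref).encard
      ≤ (#D).choose (5 * s) * ((m - 5 * s + m).choose m : ℕ) :=
        encard_le_choose_mul_of_le_card_inter hinter fun T hT =>
          hT ▸ encard_reachableSets_superset_le T
    _ ≤ (2 * m - s).choose m := by rw [hD]; exact_mod_cast choose_six_mul_mul_choose_le hsm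

theorem encard_reachableSets_le {s : ℕ} (hs : 6 * s ^ 2 ≤ Fintype.card A) :
    (reachableSets pref).encard ≤ (2 * Fintype.card A - s).choose (Fintype.card A) := by
  classical
  rcases (reachableSets pref).eq_empty_or_nonempty with hempty | ⟨E₀, hE₀⟩
  · simp [hempty]
  have hsA : s ≤ Fintype.card A := by nlinarith [Nat.le_self_pow two_ne_zero s]
  let X : Finset B := {b ∈ E₀ | ∀ E ∈ reachableSets pref, b ∈ E}
  rcases le_or_gt s #X with hsX | hXs
  · obtain ⟨T, hTX, rfl⟩ := exists_subset_card_eq hsX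
    calc (reachableSets pref).encard ≤ {E ∈ reachableSets pref | T ⊆ E}.encard :=
          Set.encard_le_encard fun E hE => ⟨hE, fun b hb => (mem_filter.mp (hTX hb)).2 E hE⟩
      _ ≤ _ := encard_reachableSets_superset_le T
      _ = _ := by rw [← Nat.sub_add_comm hsA, ← two_mul]
  · obtain ⟨b, -, hb⟩ := exists_mem_notMem_of_card_lt_card
      (hXs.trans_le (hsA.trans_eq (card_of_mem_reachableSets hE₀).symm))
    refine encard_reachableSets_le_of_card_le (X := X) ⟨b, hb⟩ (fun b hb => ?_)
      (Nat.ne_zero_of_lt hXs) hXs.le hs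
    by_contra! hall
    exact hb (mem_filter.mpr ⟨hall E₀ hE₀, hall⟩)

end ReachableSets

theorem theorem1_general :
    (∀ m s : ℕ, 6 * s ^ 2 ≤ m → ∀ (B : Type u) (pref : Fin m → B → B → Prop)
      [∀ a, IsWellOrder B (pref a)],
      (reachableSets pref).encard ≤ ((2 * m - s).choose m : ℕ∞)) ∧
    (∀ (m : ℕ) (α : Type u) (F : Set (Finset α)), HasPropertyP m F →
      F.encard ≤ ((2 * m - 1).choose m : ℕ∞)) :=
  ⟨fun m s hs B pref _ => by
    simpa using encard_reachableSets_le (pref := pref) (s := s) (by simpa using hs),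
    fun _ _ _ hF => hF.encard_le⟩

theorem theorem1 :
    (∃ M : ℕ, ∀ m : ℕ, M ≤ m → ∀ l : ℕ, IsGreatest {n : ℕ | n ^ n ≤ m} l →
      maxReachable.{u} m ≤ ((2 * m - l + 4).choose m : ℕ∞)) ∧
    (∀ m : ℕ,
      (∀ (α : Type u) (F : Set (Finset α)), HasPropertyP m F →
        F.encard ≤ ((2 * m - 1).choose m : ℕ∞)) ∧
      maxPropertyP.{u} m ≤ ((2 * m - 1).choose m : ℕ∞)) := by
  refine ⟨⟨0, fun m _ l hl => iSup₂_le fun B _ => iSup₂_le fun pref _ => ?_⟩, fun m =>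
    ⟨theorem1_general.2 m, iSup₂_le fun α F => iSup_le (theorem1_general.2 m α F)⟩⟩
  exact (theorem1_general.1 m (l - 4) (six_mul_sq_sub_four_le_of_pow_self_le hl.1) B pref).trans
    (Nat.cast_le.mpr (Nat.choose_le_choose m (by omega)))
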